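/- Let $a>b>0$, $p^2=a^2+b^2$, $r^2=a^2-b^2$. Consider the Kowalevski top in two constant fields, $$2\dot\omega_1=\omega_2\omega_3+\beta_3,\quad 2\dot\omega_2=-\omega_1\omega_3-\alpha_3,\quad \dot\omega_3=\alpha_2-\beta_1,\quad \dot{\boldsymbol\alpha}=\boldsymbol\alpha\times\boldsymbol\omega,\quad \dot{\boldsymbol\beta}=\boldsymbol\beta\times\boldsymbol\omega,$$ on $P^6=\{|\boldsymbol\alpha|=a,\ |\boldsymbol\beta|=b,\ \boldsymbol\alpha\cdot\boldsymbol\beta=0\}$. Put $x_1=(\alpha_1-\beta_2)+i(\alpha_2+\beta_1)$, $y_1=(\alpha_1+\beta_2)+i(\alpha_2-\beta_1)$, $z_1=\alpha_3+i\beta_3$, $w_1=\omega_1+i\omega_2$, $x_2=\overline{x_1}$, $y_2=\overline{y_1}$, $z_2=\overline{z_1}$, $w_2=\overline{w_1}$, $w_3=\omega_3$. Let $\mathfrak O\subset P^6$ be the set of points with $w_1\neq0$ at which $R_1=R_2=0$, where $$R_1=\frac{w_2x_1+w_1y_2+w_3z_1}{w_1}-\frac{w_1x_2+w_2y_1+w_3z_2}{w_2},$$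 $$R_2=(w_2z_1+w_1z_2)w_3^2+\Bigl[\frac{w_2z_1^2}{w_1}+\frac{w_1z_2^2}{w_2}+w_1w_2(y_1+y_2)+x_1w_2^2+x_2w_1^2\Bigr]w_3+\frac{w_2^2x_1z_1}{w_1}+\frac{w_1^2x_2z_2}{w_2}+x_1z_2w_2+x_2z_1w_1+(w_1z_2-w_2z_1)(y_1-y_2).$$ With $M_1=2\omega_1$, $M_2=2\omega_2$, $M_\alpha=2\omega_1\alpha_1+2\omega_2\alpha_2+\omega_3\alpha_3$, $M_\beta=2\omega_1\beta_1+2\omega_2\beta_2+\omega_3\beta_3$, let $$S=-\frac{M_\alpha M_1+M_\beta M_2}{M_1^2+M_2^2},\qquad \mathrm T=\tfrac12(M_\alpha M_1+M_\beta M_2)-2(\alpha_1\beta_2-\alpha_2\beta_1)+a^2+b^2,$$ $$K=(\omega_1^2-\omega_2^2+\alpha_1-\beta_2)^2+(2\omega_1\omega_2+\alpha_2+\beta_1)^2.$$ Consider a motion that stays in $\mathfrak O$ on an open time interval $I$, and let $s,\tau,k$ be the values of $S,\mathrm T,K$ on it (at some moment of $I$). Put $\sigma=\tau^2-2p^2\tau+r^4$,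 $\chi=\sqrt k$, and suppose $\tau\sigma\ne0$. Put $x=\sqrt{x_1x_2}\ge0$, $\xi=2sw_1w_2$, $\mu=|r^2x_1-\tau y_1|\ge 0$; fix any complex values of the roots $\sqrt\sigma$ and $\sqrt{2s\tau\sigma}$, and at the moments of $I$ when $x^2\ne\tau$ put $$U=\frac{\tau\xi+x\mu}{\sqrt\sigma(\tau-x^2)},\qquad V=\frac{\tau\xi-x\mu}{\sqrt\sigma(\tau-x^2)},$$ $$Q(w)=(w^2-1)(\sigma w^2-4s^2\chi^2)\bigl[(\sqrt\sigma\,w+\tau)^2-r^4\bigr].$$ Then $s\neq0$, $\sqrt{2s\tau\sigma}\ne0$, $Q$ has degree exactly $6$, and $U,V$ are differentiable in $t$ at every moment when $x^2\neq\tau$, $x\ne0$ and $\mu\neq0$. Moreover there are branches $\sqrt{Q(U)}$, $\sqrt{Q(V)}$, continuous in $t$ at all moments of $I$ with $x^2\ne\tau$, such that wherever $U,V$ are defined and differentiable $$(U-V)\frac{dU}{dt}=\frac{\sqrt{Q(U)}}{\sqrt{2s\tau\sigma}},\qquad (U-V)\frac{dV}{dt}=\frac{\sqrt{Q(V)}}{\sqrt{2s\tau\sigma}},$$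 and, if moreover $Q(U)Q(V)\neq0$, the variables separate into the hyperelliptic quadratures $$\frac{dU}{\sqrt{Q(U)}}-\frac{dV}{\sqrt{Q(V)}}=0,\qquad \frac{U\,dU}{\sqrt{Q(U)}}-\frac{V\,dV}{\sqrt{Q(V)}}=\frac{dt}{\sqrt{2s\tau\sigma}}.$$ -/

import Mathlib

open Polynomial

/-- A point of `ℝ⁹(ω, α, β)`: the components, in the principal axes of inertia, of the angular
velocity and of the two constant fields. The indices `0, 1, 2` stand for `1, 2, 3`. -/
structure TopState where
  ω : Fin 3 → ℝ
  α : Fin 3 → ℝ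
  β : Fin 3 → ℝ

namespace TopState

noncomputable section

/-- The phase space `P⁶`, cut out by the geometric integrals. -/
def phaseSpace (a b : ℝ) : Set TopState :=
  {q | q.α 0 ^ 2 + q.α 1 ^ 2 + q.α 2 ^ 2 = a ^ 2 ∧
       q.β 0 ^ 2 + q.β 1 ^ 2 + q.β 2 ^ 2 = b ^ 2 ∧
       q.α 0 * q.β 0 + q.α 1 * q.β 1 + q.α 2 * q.β 2 = 0}

/-- The Euler-Poisson equations of the Kowalevski top in two constant fields, at time `t`. -/
def EulerPoissonAt (q : ℝ → TopState) (t : ℝ) : Prop :=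
  (∃ w : Fin 3 → ℝ, (∀ j, HasDerivAt (fun u => (q u).ω j) (w j) t) ∧
    2 * w 0 = (q t).ω 1 * (q t).ω 2 + (q t).β 2 ∧
    2 * w 1 = -((q t).ω 0 * (q t).ω 2) - (q t).α 2 ∧
    w 2 = (q t).α 1 - (q t).β 0) ∧
  (HasDerivAt (fun u => (q u).α 0) ((q t).α 1 * (q t).ω 2 - (q t).α 2 * (q t).ω 1) t ∧
   HasDerivAt (fun u => (q u).α 1) ((q t).α 2 * (q t).ω 0 - (q t).α 0 * (q t).ω 2) t ∧
   HasDerivAt (fun u => (q u).α 2) ((q t).α 0 * (q t).ω 1 - (q t).α 1 * (q t).ω 0) t) ∧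
  (HasDerivAt (fun u => (q u).β 0) ((q t).β 1 * (q t).ω 2 - (q t).β 2 * (q t).ω 1) t ∧
   HasDerivAt (fun u => (q u).β 1) ((q t).β 2 * (q t).ω 0 - (q t).β 0 * (q t).ω 2) t ∧
   HasDerivAt (fun u => (q u).β 2) ((q t).β 0 * (q t).ω 1 - (q t).β 1 * (q t).ω 0) t)

/-! The complex phase variables. -/

def x₁ (q : TopState) : ℂ := ⟨q.α 0 - q.β 1, q.α 1 + q.β 0⟩
def x₂ (q : TopState) : ℂ := ⟨q.α 0 - q.β 1, -(q.α 1 + q.β 0)⟩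
def y₁ (q : TopState) : ℂ := ⟨q.α 0 + q.β 1, q.α 1 - q.β 0⟩
def y₂ (q : TopState) : ℂ := ⟨q.α 0 + q.β 1, -(q.α 1 - q.β 0)⟩
def z₁ (q : TopState) : ℂ := ⟨q.α 2, q.β 2⟩
def z₂ (q : TopState) : ℂ := ⟨q.α 2, -q.β 2⟩
def w₁ (q : TopState) : ℂ := ⟨q.ω 0, q.ω 1⟩
def w₂ (q : TopState) : ℂ := ⟨q.ω 0, -q.ω 1⟩
def w₃ (q : TopState) : ℂ := (q.ω 2 : ℂ)

/-- The first function whose zero level defines the invariant set `𝔒`. -/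
def R₁ (q : TopState) : ℂ :=
  (q.w₂ * q.x₁ + q.w₁ * q.y₂ + q.w₃ * q.z₁) / q.w₁
    - (q.w₁ * q.x₂ + q.w₂ * q.y₁ + q.w₃ * q.z₂) / q.w₂

/-- The second function whose zero level defines the invariant set `𝔒`. -/
def R₂ (q : TopState) : ℂ :=
  (q.w₂ * q.z₁ + q.w₁ * q.z₂) * q.w₃ ^ 2
    + (q.w₂ * q.z₁ ^ 2 / q.w₁ + q.w₁ * q.z₂ ^ 2 / q.w₂ + q.w₁ * q.w₂ * (q.y₁ + q.y₂)
        + q.x₁ * q.w₂ ^ 2 + q.x₂ * q.w₁ ^ 2) * q.w₃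
    + q.w₂ ^ 2 * q.x₁ * q.z₁ / q.w₁ + q.w₁ ^ 2 * q.x₂ * q.z₂ / q.w₂
    + q.x₁ * q.z₂ * q.w₂ + q.x₂ * q.z₁ * q.w₁
    + (q.w₁ * q.z₂ - q.w₂ * q.z₁) * (q.y₁ - q.y₂)

/-- The invariant set `𝔒` (without the pendulum motions): `R₁ = R₂ = 0` in `P⁶`, at points
where the fractions in `R₁`, `R₂` make sense, that is, `w₁ ≠ 0` (equivalently `w₂ ≠ 0`). -/
def setO (a b : ℝ) : Set TopState :=
  {q | q ∈ phaseSpace a b ∧ q.w₁ ≠ 0 ∧ q.R₁ = 0 ∧ q.R₂ = 0}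

/-- `M_α = Iω · α` with `I = diag(2, 2, 1)`. -/
def Mα (q : TopState) : ℝ :=
  2 * q.ω 0 * q.α 0 + 2 * q.ω 1 * q.α 1 + q.ω 2 * q.α 2

/-- `M_β = Iω · β`. -/
def Mβ (q : TopState) : ℝ :=
  2 * q.ω 0 * q.β 0 + 2 * q.ω 1 * q.β 1 + q.ω 2 * q.β 2

/-- `M₁ = Iω · e₁`. -/
def M₁ (q : TopState) : ℝ := 2 * q.ω 0

/-- `M₂ = Iω · e₂`. -/
def M₂ (q : TopState) : ℝ := 2 * q.ω 1

/-- The general first integral `K`. -/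
def K (q : TopState) : ℝ :=
  (q.ω 0 ^ 2 - q.ω 1 ^ 2 + q.α 0 - q.β 1) ^ 2 + (2 * q.ω 0 * q.ω 1 + q.α 1 + q.β 0) ^ 2

/-- The partial integral `S` on `𝔒`. -/
def S (q : TopState) : ℝ :=
  -((q.Mα * q.M₁ + q.Mβ * q.M₂) / (q.M₁ ^ 2 + q.M₂ ^ 2))

/-- The partial integral `Τ` on `𝔒`. -/
def T (a b : ℝ) (q : TopState) : ℝ :=
  (1 / 2) * (q.Mα * q.M₁ + q.Mβ * q.M₂) - 2 * (q.α 0 * q.β 1 - q.α 1 * q.β 0) + a ^ 2 + b ^ 2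

/-- `x = √(x₁ x₂) ≥ 0`; here `x₂` is the complex conjugate of `x₁`. -/
def x (q : TopState) : ℝ := ‖q.x₁‖

/-- `ξ = 2 s w₁ w₂`, where `w₁ w₂ = ω₁² + ω₂²`. -/
def ξ (s : ℝ) (q : TopState) : ℝ := 2 * s * (q.ω 0 ^ 2 + q.ω 1 ^ 2)

/-- `μ = |r² x₁ - τ y₁|`. -/
def μ (r τ : ℝ) (q : TopState) : ℝ := ‖(r : ℂ) ^ 2 * q.x₁ - (τ : ℂ) * q.y₁‖

/-- The variable `U`; `c` is a square root of `σ`. -/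
def U (r s τ : ℝ) (c : ℂ) (q : TopState) : ℂ :=
  ((τ * q.ξ s + q.x * q.μ r τ : ℝ) : ℂ) / (c * ((τ - q.x ^ 2 : ℝ) : ℂ))

/-- The variable `V`; `c` is a square root of `σ`. -/
def V (r s τ : ℝ) (c : ℂ) (q : TopState) : ℂ :=
  ((τ * q.ξ s - q.x * q.μ r τ : ℝ) : ℂ) / (c * ((τ - q.x ^ 2 : ℝ) : ℂ))

/-- `σ = τ² - 2 p² τ + r⁴`. -/
def sigma (p r τ : ℝ) : ℝ := τ ^ 2 - 2 * p ^ 2 * τ + r ^ 4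

/-- `Q(w) = (w² - 1) (σ w² - 4 s² χ²) ((√σ w + τ)² - r⁴)`; `c` is a square root of `σ`. -/
def sexticQ (p r s τ χ : ℝ) (c : ℂ) : ℂ[X] :=
  (X ^ 2 - 1) * (C (sigma p r τ : ℂ) * X ^ 2 - C ((4 * s ^ 2 * χ ^ 2 : ℝ) : ℂ))
    * ((C c * X + C (τ : ℂ)) ^ 2 - C ((r ^ 4 : ℝ) : ℂ))

end

end TopState

/-!
Write `X = x²`, `σ = τ² - 2p²τ + r⁴`, and let a dot denote `d/dt`. On `𝔒` the equation `R₁ = 0` says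
that the complex number `(w₂x₁ + w₁y₂ + w₃z₁)/w₁` is real; its value is `-2S`. Together with the
definition of `Τ` and the equation `R₂ = 0` this gives, with `S = s` and `Τ = τ`,
* `w₂x₁ + w₁y₂ + w₃z₁ = -2sw₁` and its conjugate (`S_eq₁`, `S_eq₂`),
* `ξ = 2sw₁w₂ = x₁x₂ + z₁z₂ - τ` (`T_eq`),
* `x₂z₁w₁ + x₁z₂w₂ + (τ - X)w₃ = 0` (`R₂_eq`).

The first of these, along the flow, shows that `S` and `Τ` are constant; `K` is a general first integral.
Elimination of `w₃` yields `2sx₁w₂² = τy₂ - r²x₂ + 2s(τ - X)`, whence `4s²k = 4s²τ + σ`,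
while the geometric integrals yield `μ² = σ(X - τ) + τξ²` (`mu_sq_identity`). Thus `U + V` and
`(U - V)²` are rational functions of `X` and `ξ` alone, and they are differentiable without any
condition on `x` and `μ`. Therefore
`(U - V)U̇ = ¼ d/dt (U - V)² + ½ (U - V) d/dt (U + V)`
expresses `(U - V)U̇` through `X`, `ξ`, `Ẋ`, `ξ̇` and `m = xμ`, linearly in `Ẋ` and `ξ̇`
(`sub_mul_deriv_eq_branchNumerator`); `(U - V)V̇` arises from it by `m ↦ -m` and a change of sign.
These expressions, times `√(2sτσ)`, are the branches of `√Q(U)` and `√Q(V)`: they are continuous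
wherever `X ≠ τ`, even where `xμ = 0`.

That their squares are `Q(U)` and `Q(V)` is an algebraic identity. The numbers `Ẋ²`, `Ẋξ̇`, `Xξ̇²`
are affine functions of `y₁ + y₂` with coefficients depending on `X`, `ξ` only; `y₁ + y₂` drops out
of the combination that occurs (`separation_identity`), and each of the three factors of `Q(U)` is
matched with a factor of the result (`sq_branch_eq_eval`).

Finally `s = 0` would force `r²z₂ = z₁(|z₁|² + |y₁|²)`, hence either `z₁ = 0` and `σ = 0`, or
`|z₁|² + |y₁|² = r²`, which is incompatible with `x² + |y₁|² + 2|z₁|² = 2p²` because `b ≠ 0`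
(`S_ne_zero`).
-/

namespace TopState

/-! ### Algebraic consequences of the defining relations -/

section Algebra

variable {x1 x2 y1 y2 z1 z2 w1 w2 w3 s τ ρ π k : ℂ}

/-- The result of eliminating `w₃`. In the complex variables the algebra does not use that paired
variables are conjugate, so they are treated as independent. -/
theorem two_s_mul_x_mul_w_sq (hw1 : w1 ≠ 0)
    (hz : z1 ^ 2 + x1 * y2 = ρ)
    (hG : w2 * x1 + w1 * y2 + w3 * z1 = -2 * s * w1)
    (hW : x2 * z1 * w1 + x1 * z2 * w2 + (τ - x1 * x2) * w3 = 0)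
    (hT : 2 * s * (w1 * w2) = x1 * x2 + z1 * z2 - τ) :
    2 * s * (x1 * w2 ^ 2) = τ * y2 - ρ * x2 + 2 * s * (τ - x1 * x2) := by
  apply mul_left_cancel₀ hw1
  linear_combination -(τ - x1 * x2) * hG + z1 * hW - (x2 * w1) * hz + (x1 * w2) * hT

/-- `(r² - z₁²)(r² - z₂²) = |x₁|²|y₁|²`, with `|y₁|²` eliminated. Here `ρ = r²` and `π = p²`. -/
theorem r_sq_mul_z_sq
    (hz1 : z1 ^ 2 + x1 * y2 = ρ) (hz2 : z2 ^ 2 + x2 * y1 = ρ)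
    (hn : x1 * x2 + y1 * y2 + 2 * (z1 * z2) = 2 * π) :
    ρ * (z1 ^ 2 + z2 ^ 2) = ρ ^ 2 + (x1 * x2 + z1 * z2) ^ 2 - 2 * π * (x1 * x2) := by
  linear_combination -(x1 * x2) * hn + (ρ - z2 ^ 2) * hz1 + x1 * y2 * hz2

/-- `μ² = σ(X - τ) + τξ²`, with `ρ = r²` and `π = p²`. -/
theorem mu_sq_identity
    (hz1 : z1 ^ 2 + x1 * y2 = ρ) (hz2 : z2 ^ 2 + x2 * y1 = ρ)
    (hn : x1 * x2 + y1 * y2 + 2 * (z1 * z2) = 2 * π) (ξ : ℂ)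
    (hT : ξ = x1 * x2 + z1 * z2 - τ) :
    (ρ * x1 - τ * y1) * (ρ * x2 - τ * y2) =
      (τ ^ 2 - 2 * π * τ + ρ ^ 2) * (x1 * x2 - τ) + τ * ξ ^ 2 := by
  have h := r_sq_mul_z_sq hz1 hz2 hn
  subst hT
  linear_combination τ * h - τ * ρ * hz1 - τ * ρ * hz2 + τ ^ 2 * hn

/-- The algebraic core of the separation of variables. Here `P` and `N` are the time derivatives of
`X = x²` and of `ξ`, `m` is either square root of `x²μ²`, and `ρ = r²`, `π = p²`. -/
theorem separation_identity
    (hw1 : w1 ≠ 0) (hw2 : w2 ≠ 0) (hτX : τ - x1 * x2 ≠ 0)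
    (hz1 : z1 ^ 2 + x1 * y2 = ρ) (hz2 : z2 ^ 2 + x2 * y1 = ρ)
    (hn : x1 * x2 + y1 * y2 + 2 * (z1 * z2) = 2 * π)
    (hG1 : w2 * x1 + w1 * y2 + w3 * z1 = -2 * s * w1)
    (hG2 : w1 * x2 + w2 * y1 + w3 * z2 = -2 * s * w2)
    (hW : x2 * z1 * w1 + x1 * z2 * w2 + (τ - x1 * x2) * w3 = 0)
    (hT : 2 * s * (w1 * w2) = x1 * x2 + z1 * z2 - τ)
    (hK : (w1 ^ 2 + x1) * (w2 ^ 2 + x2) = k)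
    {X ξ P N m σ : ℂ} (hX : X = x1 * x2) (hξ : ξ = 2 * s * (w1 * w2))
    (hσ : σ = τ ^ 2 - 2 * π * τ + ρ ^ 2)
    (hP : P = Complex.I * (x2 * z1 * w1 - x1 * z2 * w2))
    (hN : N = Complex.I * (s * (w1 * z2 - w2 * z1)))
    (hm : m ^ 2 = X * (σ * (X - τ) + τ * ξ ^ 2)) :
    4 * s ^ 2 * k = 4 * s ^ 2 * τ + σ ∧
    2 * s * (P ^ 2 * ((τ + X) * ξ ^ 2 + 2 * ξ * m - σ * (τ - X))
        + 4 * (τ - X) * (P * N) * (X * ξ + m) + 4 * (τ - X) ^ 2 * (X * N ^ 2)) =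
      ((τ + X) * ξ ^ 2 + 2 * ξ * m - σ * (τ - X) - 4 * s ^ 2 * (τ - X) ^ 2) *
      ((τ + X) * ξ ^ 2 + 2 * ξ * m - σ * (τ - X) + 2 * (τ * ξ + m) * (τ - X)
        + 2 * (τ - π) * (τ - X) ^ 2) := by
  have hE1 := two_s_mul_x_mul_w_sq hw1 hz1 hG1 hW hT
  have hE2 : 2 * s * (x2 * w1 ^ 2) = τ * y1 - ρ * x1 + 2 * s * (τ - x1 * x2) := by
    have := two_s_mul_x_mul_w_sq (x1 := x2) (x2 := x1) (y2 := y1) (z1 := z2) (z2 := z1)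
      (w2 := w1) (w3 := w3) (s := s) (τ := τ) (ρ := ρ) hw2 hz2 (by linear_combination hG2)
      (by linear_combination hW) (by linear_combination hT)
    linear_combination this
  have hZ := r_sq_mul_z_sq hz1 hz2 hn
  have hμ := mu_sq_identity hz1 hz2 hn ξ (hξ.trans hT)
  have hk : 4 * s ^ 2 * k = 4 * s ^ 2 * τ + σ := by
    apply mul_left_cancel₀ hτX
    rw [hσ, ← hK]
    linear_combination -hμ - 2 * s * (x2 * w1 ^ 2) * hE1
      - (τ * y2 - ρ * x2 + 2 * s * (τ - x1 * x2)) * hE2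
      + 2 * s * (τ - x1 * x2) * (hE1 + hE2)
      - τ * (ξ + 2 * s * (w1 * w2)) * hξ
  refine ⟨hk, ?_⟩
  set A1 := x1 * w2 ^ 2 with hA1
  set A2 := x2 * w1 ^ 2 with hA2
  have hzz : z1 * z2 = ξ + τ - X := by linear_combination -hT - hξ + hX
  have hyy : y1 * y2 = 2 * π - X - 2 * (ξ + τ - X) := by
    linear_combination hn - 2 * hzz + hX
  have hEE : 4 * s ^ 2 * (A1 * A2) = X * ξ ^ 2 := by
    rw [hA1, hA2, hX, hξ]; ring
  have hsum : 4 * s ^ 2 * (A1 + A2) = 4 * s ^ 2 * (τ - X) + σ - ξ ^ 2 := by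
    rw [hA1, hA2, hX, hξ]; linear_combination hk + 4 * s ^ 2 * hK
  have hxz1 : x2 * z1 ^ 2 = (τ - X) * y2 + 2 * s * (τ - X) - 2 * s * A1 := by
    rw [hX]; linear_combination x2 * hz1 + hE1
  have hxz2 : x1 * z2 ^ 2 = (τ - X) * y1 + 2 * s * (τ - X) - 2 * s * A2 := by
    rw [hX]; linear_combination x1 * hz2 + hE2
  have hI := Complex.I_sq
  rw [← hX] at hE1 hE2
  have hZ' : ρ * (z1 ^ 2 + z2 ^ 2) = (σ - τ ^ 2 + 2 * π * τ) + (ξ + τ) ^ 2 - 2 * π * X := by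
    rw [hZ, hzz, hσ, ← hX]; ring
  -- these two sums are affine in `y1 + y2`: in `hD` the quadratic terms cancel
  have hC : 2 * s * (A2 * y2 + A1 * y1) =
      2 * τ * (2 * π - X - 2 * (ξ + τ - X)) - (σ - τ ^ 2 + 2 * π * τ) + (ξ + τ) ^ 2 - 2 * π * X
        + 2 * s * (τ - X) * (y1 + y2) := by
    linear_combination y1 * hE1 + y2 * hE2 + 2 * τ * hyy - ρ * hz1 - ρ * hz2 + hZ' + 2 * hσ
  have hD : 2 * s * (A1 * y2 + A2 * y1) =
      (2 * s * (A1 + A2) - 4 * s * (τ - X)) * (y1 + y2)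
      - 2 * τ * (2 * π - X - 2 * (ξ + τ - X)) + (σ - τ ^ 2 + 2 * π * τ) - (ξ + τ) ^ 2 + 2 * π * X
        + 2 * s * (τ - X) * (y1 + y2) := by
    linear_combination -y1 * hE1 - y2 * hE2 - 2 * τ * hyy + ρ * hz1 + ρ * hz2 - hZ' - 2 * hσ
  have hww : 2 * s * (w1 * w2) = ξ := hξ.symm
  have hP2 : 2 * s * P ^ 2 = -(τ - X) * (2 * s * (A2 * y2 + A1 * y1))
      - (τ - X) * (4 * s ^ 2 * (A1 + A2)) + 2 * X * ξ ^ 2 + 2 * X * (ξ + τ - X) * ξ := by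
    have h1 : P ^ 2 = -(A2 * (x2 * z1 ^ 2) + A1 * (x1 * z2 ^ 2))
        + 2 * X * (z1 * z2) * (w1 * w2) := by
      rw [hP, hA1, hA2, hX]
      linear_combination (x2 * z1 * w1 - x1 * z2 * w2) ^ 2 * hI
    rw [h1, hxz1, hxz2, hzz]
    linear_combination 2 * hEE + 2 * X * (ξ + τ - X) * hww
  have hPN : 2 * s * (P * N) = -((ξ + τ - X) * (4 * s ^ 2 * (A1 + A2)) / 2
      - ξ * s * ((τ - X) * (y1 + y2) + 4 * s * (τ - X)) + ξ * (4 * s ^ 2 * (A1 + A2)) / 2) := by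
    have h1 : P * N = -s * ((z1 * z2) * (A1 + A2)
        - (w1 * w2) * (x2 * z1 ^ 2 + x1 * z2 ^ 2)) := by
      rw [hP, hN, hA1, hA2]
      linear_combination (s * (x2 * z1 * w1 - x1 * z2 * w2) * (w1 * z2 - w2 * z1)) * hI
    rw [h1, hxz1, hxz2, hzz, ← hww]
    ring
  have hN2 : 2 * s * (X * N ^ 2) = -s ^ 2 * ((τ - X) * (2 * s * (A1 * y2 + A2 * y1))
      + (τ - X) * (4 * s ^ 2 * (A1 + A2)) - 4 * s ^ 2 * (A1 + A2) ^ 2 + 2 * X * ξ ^ 2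
      - 2 * X * ξ * (ξ + τ - X)) := by
    have h1 : X * N ^ 2 = -s ^ 2 * (A1 * (x2 * z1 ^ 2) + A2 * (x1 * z2 ^ 2)
        - 2 * X * (w1 * w2) * (z1 * z2)) := by
      rw [hN, hA1, hA2, hX]
      linear_combination (s ^ 2 * (x1 * x2) * (w1 * z2 - w2 * z1) ^ 2) * hI
    rw [h1, hxz1, hxz2, hzz]
    linear_combination 2 * s ^ 2 * X * (ξ + τ - X) * hww - 2 * s ^ 2 * hEE
  rw [hC] at hP2
  rw [hD] at hN2
  generalize A1 + A2 = Z at *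
  generalize y1 + y2 = Y at *
  have hZ4 : 4 * s ^ 2 * Z ^ 2 * (4 * s ^ 2) = (4 * s ^ 2 * (τ - X) + σ - ξ ^ 2) ^ 2 := by
    rw [← hsum]; ring
  rw [hsum] at hP2 hPN hN2
  linear_combination ((τ + X) * ξ ^ 2 + 2 * ξ * m - σ * (τ - X)) * hP2
    + 4 * (τ - X) * (X * ξ + m) * hPN + 4 * (τ - X) ^ 2 * hN2
    + (τ - X) ^ 2 * hZ4 - 2 * s * (τ - X) ^ 3 * Y * hsum
    - 4 * ξ * (ξ + (τ - X)) * hm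

end Algebra

/-! ### The relations on the invariant set in complex variables -/

theorem r₁_eq (q : TopState) (h1 : q.w₁ ≠ 0) (h2 : q.w₂ ≠ 0) (hR : q.R₁ = 0) :
    q.w₂ * (q.w₂ * q.x₁ + q.w₁ * q.y₂ + q.w₃ * q.z₁) =
      q.w₁ * (q.w₁ * q.x₂ + q.w₂ * q.y₁ + q.w₃ * q.z₂) := by
  rw [R₁, div_sub_div _ _ h1 h2, div_eq_zero_iff] at hR
  have := hR.resolve_right (mul_ne_zero h1 h2)
  linear_combination this

theorem w₂_ne_zero {q : TopState} (h : q.w₁ ≠ 0) : q.w₂ ≠ 0 := by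
  contrapose! h
  simp only [w₂, w₁, Complex.ext_iff, Complex.zero_re, Complex.zero_im, neg_eq_zero] at h ⊢
  exact h

theorem w₁_mul_w₂ (q : TopState) : q.w₁ * q.w₂ = ((q.ω 0 ^ 2 + q.ω 1 ^ 2 : ℝ) : ℂ) := by
  apply Complex.ext <;> simp [w₁, w₂, pow_two]; ring

theorem sq_add_sq_pos {q : TopState} (h : q.w₁ ≠ 0) : 0 < q.ω 0 ^ 2 + q.ω 1 ^ 2 := by
  have := Complex.normSq_pos.2 h
  rw [Complex.normSq_apply] at this
  simp only [w₁] at this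
  nlinarith

theorem x₁_mul_x₂ (q : TopState) : q.x₁ * q.x₂ = ((q.x ^ 2 : ℝ) : ℂ) := by
  have : q.x₂ = (starRingEnd ℂ) q.x₁ := by apply Complex.ext <;> simp [x₁, x₂]
  rw [this, Complex.mul_conj, x, Complex.normSq_eq_norm_sq]

theorem y₁_mul_y₂ (q : TopState) : q.y₁ * q.y₂ = ((‖q.y₁‖ ^ 2 : ℝ) : ℂ) := by
  have : q.y₂ = (starRingEnd ℂ) q.y₁ := by apply Complex.ext <;> simp [y₁, y₂]
  rw [this, Complex.mul_conj, Complex.normSq_eq_norm_sq]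

theorem z₁_mul_z₂ (q : TopState) : q.z₁ * q.z₂ = ((‖q.z₁‖ ^ 2 : ℝ) : ℂ) := by
  have : q.z₂ = (starRingEnd ℂ) q.z₁ := by apply Complex.ext <;> simp [z₁, z₂]
  rw [this, Complex.mul_conj, Complex.normSq_eq_norm_sq]

theorem μ_sq (q : TopState) (r τ : ℝ) : ((q.μ r τ ^ 2 : ℝ) : ℂ) =
    ((r : ℂ) ^ 2 * q.x₁ - τ * q.y₁) * ((r : ℂ) ^ 2 * q.x₂ - τ * q.y₂) := by
  have : ((r : ℂ) ^ 2 * q.x₂ - τ * q.y₂) =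
      (starRingEnd ℂ) ((r : ℂ) ^ 2 * q.x₁ - τ * q.y₁) := by
    apply Complex.ext <;> simp [x₁, x₂, y₁, y₂, ← Complex.ofReal_pow]
  rw [this, Complex.mul_conj, μ, Complex.normSq_eq_norm_sq]

section PhaseSpace

variable {a b p r : ℝ} {q : TopState}

theorem z₁_sq_add (hr : r ^ 2 = a ^ 2 - b ^ 2) (hq : q ∈ phaseSpace a b) :
    q.z₁ ^ 2 + q.x₁ * q.y₂ = (r : ℂ) ^ 2 := by
  obtain ⟨h1, h2, h3⟩ := hq
  rw [← Complex.ofReal_pow, hr]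
  apply Complex.ext <;> simp [z₁, x₁, y₂, pow_two] <;> linarith

theorem z₂_sq_add (hr : r ^ 2 = a ^ 2 - b ^ 2) (hq : q ∈ phaseSpace a b) :
    q.z₂ ^ 2 + q.x₂ * q.y₁ = (r : ℂ) ^ 2 := by
  obtain ⟨h1, h2, h3⟩ := hq
  rw [← Complex.ofReal_pow, hr]
  apply Complex.ext <;> simp [z₂, x₂, y₁, pow_two] <;> linarith

theorem sum_sq (hp : p ^ 2 = a ^ 2 + b ^ 2) (hq : q ∈ phaseSpace a b) :
    q.x₁ * q.x₂ + q.y₁ * q.y₂ + 2 * (q.z₁ * q.z₂) = 2 * (p : ℂ) ^ 2 := by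
  obtain ⟨h1, h2, h3⟩ := hq
  rw [← Complex.ofReal_pow, hp]
  apply Complex.ext <;> simp [x₁, x₂, y₁, y₂, z₁, z₂, pow_two] <;> linarith

theorem K_eq (q : TopState) :
    (q.w₁ ^ 2 + q.x₁) * (q.w₂ ^ 2 + q.x₂) = (q.K : ℂ) := by
  apply Complex.ext <;> simp [K, w₁, w₂, x₁, x₂, pow_two] <;> ring

/-- The value `M_α M₁ + M_β M₂ = -4S w₁w₂` is twice the real part of `w₂(w₂x₁ + w₁y₂ + w₃z₁)`.
This needs no equation of `𝔒`. -/
theorem S_mul (h : q.w₁ ≠ 0) :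
    q.w₂ * (q.w₂ * q.x₁ + q.w₁ * q.y₂ + q.w₃ * q.z₁) +
      q.w₁ * (q.w₁ * q.x₂ + q.w₂ * q.y₁ + q.w₃ * q.z₂) = -4 * q.S * (q.w₁ * q.w₂) := by
  have hS : q.S * (4 * (q.ω 0 ^ 2 + q.ω 1 ^ 2)) = -(q.Mα * q.M₁ + q.Mβ * q.M₂) := by
    have := (sq_add_sq_pos h).ne'
    rw [S, M₁, M₂]
    field_simp
    ring
  rw [w₁_mul_w₂]
  have : (-4 * q.S * ((q.ω 0 ^ 2 + q.ω 1 ^ 2 : ℝ) : ℂ)) =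
      ((q.Mα * q.M₁ + q.Mβ * q.M₂ : ℝ) : ℂ) := by
    rw [← neg_eq_iff_eq_neg.2 hS]; push_cast; ring
  rw [this]
  apply Complex.ext <;> simp [Mα, Mβ, M₁, M₂, w₁, w₂, w₃, x₁, x₂, y₁, y₂, z₁, z₂] <;> ring

/-- `R₁ = 0` makes `(w₂x₁ + w₁y₂ + w₃z₁)/w₁` real, and its real part is always `-2S`. -/
theorem S_eq₁ (hq : q ∈ setO a b) :
    q.w₂ * q.x₁ + q.w₁ * q.y₂ + q.w₃ * q.z₁ = -2 * q.S * q.w₁ := by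
  obtain ⟨-, h1, hR, -⟩ := hq
  have h2 := w₂_ne_zero h1
  apply mul_left_cancel₀ h2
  linear_combination (1 / 2) * S_mul h1 + (1 / 2) * r₁_eq q h1 h2 hR

theorem S_eq₂ (hq : q ∈ setO a b) :
    q.w₁ * q.x₂ + q.w₂ * q.y₁ + q.w₃ * q.z₂ = -2 * q.S * q.w₂ := by
  obtain ⟨-, h1, hR, -⟩ := hq
  have h2 := w₂_ne_zero h1
  apply mul_left_cancel₀ h1
  linear_combination (1 / 2) * S_mul h1 - (1 / 2) * r₁_eq q h1 h2 hR

theorem T_eq (hq : q ∈ setO a b) :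
    2 * q.S * (q.w₁ * q.w₂) = q.x₁ * q.x₂ + q.z₁ * q.z₂ - q.T a b := by
  obtain ⟨⟨ha, hb, -⟩, h1, -, -⟩ := hq
  have hL := S_mul h1
  rw [T, ← ha, ← hb]
  have h0 : ((q.Mα * q.M₁ + q.Mβ * q.M₂ : ℝ) : ℂ) =
     q.w₂ * (q.w₂ * q.x₁ + q.w₁ * q.y₂ + q.w₃ * q.z₁) +
      q.w₁ * (q.w₁ * q.x₂ + q.w₂ * q.y₁ + q.w₃ * q.z₂) := by
    apply Complex.ext <;> simp [Mα, Mβ, M₁, M₂, w₁, w₂, w₃, x₁, x₂, y₁, y₂, z₁, z₂] <;> ring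
  have hx : q.x₁ * q.x₂ + q.z₁ * q.z₂ =
      ((- 2 * (q.α 0 * q.β 1 - q.α 1 * q.β 0) + (q.α 0 ^ 2 + q.α 1 ^ 2 + q.α 2 ^ 2)
        + (q.β 0 ^ 2 + q.β 1 ^ 2 + q.β 2 ^ 2) : ℝ) : ℂ) := by
    apply Complex.ext <;> simp [x₁, x₂, z₁, z₂, pow_two] <;> ring
  rw [hx]
  push_cast at h0 ⊢
  linear_combination (1 / 2) * hL + (1 / 2) * h0

/-- The equation `R₂ = 0`, simplified by means of the integrals `S` and `Τ`. -/
theorem R₂_eq (hq : q ∈ setO a b) :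
    q.x₂ * q.z₁ * q.w₁ + q.x₁ * q.z₂ * q.w₂ + (q.T a b - q.x₁ * q.x₂) * q.w₃ = 0 := by
  have hG1 := S_eq₁ hq
  have hG2 := S_eq₂ hq
  have hT := T_eq hq
  obtain ⟨-, h1, -, hR⟩ := hq
  have h2 := w₂_ne_zero h1
  have hR' : q.w₁ * q.w₂ * q.R₂ = 0 := by rw [hR, mul_zero]
  rw [R₂] at hR'
  field_simp at hR'
  have : (2 * q.w₁ * q.w₂) * (q.x₂ * q.z₁ * q.w₁ + q.x₁ * q.z₂ * q.w₂
      + (q.T a b - q.x₁ * q.x₂) * q.w₃) = 0 := by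
    linear_combination hR' - q.w₁ * q.w₂ * q.w₃ * (q.w₂ * hG1 + q.w₁ * hG2)
      - q.w₂ ^ 2 * q.z₁ * hG1 - q.w₁ ^ 2 * q.z₂ * hG2 + q.w₁ * q.w₂ * (q.z₁ * hG2 + q.z₂ * hG1)
      + 2 * q.w₁ * q.w₂ * q.w₃ * hT
  exact (mul_eq_zero.1 this).resolve_left (by simp [h1, h2])

end PhaseSpace

/-! ### Evolution along the motion and the partial integrals -/

/-- The time derivative of `x² = x₁x₂` along the flow. -/
noncomputable def xSqRate (q : TopState) : ℝ := 2 * (q.x₁ * q.z₂ * q.w₂).im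

/-- The time derivative of `w₁w₂ = ω₁² + ω₂²` along the flow. -/
noncomputable def wSqRate (q : TopState) : ℝ := -(q.w₁ * q.z₂).im

theorem ofReal_xSqRate (q : TopState) :
    (q.xSqRate : ℂ) = Complex.I * (q.x₂ * q.z₁ * q.w₁ - q.x₁ * q.z₂ * q.w₂) := by
  apply Complex.ext <;> simp [xSqRate, x₁, x₂, z₁, z₂, w₁, w₂] <;> ring

theorem ofReal_wSqRate (q : TopState) :
    (q.wSqRate : ℂ) = Complex.I / 2 * (q.w₁ * q.z₂ - q.w₂ * q.z₁) := by
  apply Complex.ext <;> simp [wSqRate, z₁, z₂, w₁, w₂]; ring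

theorem x_sq (q : TopState) : q.x ^ 2 = (q.α 0 - q.β 1) ^ 2 + (q.α 1 + q.β 0) ^ 2 := by
  rw [x, ← Complex.normSq_eq_norm_sq, Complex.normSq_apply, x₁]; ring

theorem μ_sq_eq (q : TopState) (r τ : ℝ) : q.μ r τ ^ 2 =
    (r ^ 2 * (q.α 0 - q.β 1) - τ * (q.α 0 + q.β 1)) ^ 2
      + (r ^ 2 * (q.α 1 + q.β 0) - τ * (q.α 1 - q.β 0)) ^ 2 := by
  rw [μ, ← Complex.normSq_eq_norm_sq, Complex.normSq_apply]
  simp [x₁, y₁, ← Complex.ofReal_pow]; ring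

section Rates

variable {q : ℝ → TopState} {t : ℝ}

theorem EulerPoissonAt.hasDerivAt_x_sq (h : EulerPoissonAt q t) :
    HasDerivAt (fun u => (q u).x ^ 2) (q t).xSqRate t := by
  obtain ⟨-, ⟨ha0, ha1, -⟩, hb0, hb1, -⟩ := h
  simp only [x_sq]
  refine (((ha0.sub hb1).pow 2).add ((ha1.add hb0).pow 2)).congr_deriv ?_
  simp [xSqRate, x₁, z₂, w₂]
  ring

theorem EulerPoissonAt.hasDerivAt_w_sq (h : EulerPoissonAt q t) :
    HasDerivAt (fun u => (q u).ω 0 ^ 2 + (q u).ω 1 ^ 2) (q t).wSqRate t := by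
  obtain ⟨⟨w, hw, e0, e1, -⟩, -⟩ := h
  refine (((hw 0).pow 2).add ((hw 1).pow 2)).congr_deriv ?_
  simp [wSqRate, z₂, w₁]
  linear_combination (q t).ω 0 * e0 + (q t).ω 1 * e1

theorem EulerPoissonAt.hasDerivAt_K (h : EulerPoissonAt q t) :
    HasDerivAt (fun u => (q u).K) 0 t := by
  obtain ⟨⟨w, hw, e0, e1, -⟩, ⟨ha0, ha1, -⟩, hb0, hb1, -⟩ := h
  refine (((((((hw 0).pow 2).sub ((hw 1).pow 2)).add ha0).sub hb1).pow 2).add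
    ((((((hw 0).const_mul 2).mul (hw 1)).add ha1).add hb0).pow 2)).congr_deriv ?_
  simp
  linear_combination
    2 * ((q t).ω 0 ^ 2 - (q t).ω 1 ^ 2 + (q t).α 0 - (q t).β 1) * ((q t).ω 0 * e0 - (q t).ω 1 * e1)
    + 2 * (2 * (q t).ω 0 * (q t).ω 1 + (q t).α 1 + (q t).β 0)
      * ((q t).ω 1 * e0 + (q t).ω 0 * e1)

/-- The function `M_α M₁ + M_β M₂` equals `-S (M₁² + M₂²)`; on `R₁ = 0` its derivative is `-S` times
that of `M₁² + M₂²`, and hence `S` is constant. -/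
theorem EulerPoissonAt.hasDerivAt_momentum {a b : ℝ} (h : EulerPoissonAt q t)
    (hq : q t ∈ setO a b) :
    HasDerivAt (fun u => (q u).Mα * (q u).M₁ + (q u).Mβ * (q u).M₂)
      (-4 * (q t).S * (q t).wSqRate) t := by
  obtain ⟨⟨w, hw, e0, e1, e2⟩, ⟨ha0, ha1, ha2⟩, hb0, hb1, hb2⟩ := h
  have hMα : HasDerivAt (fun u => (q u).Mα) _ t :=
    ((((hw 0).const_mul 2).mul ha0).add (((hw 1).const_mul 2).mul ha1)).add ((hw 2).mul ha2)
  have hMβ : HasDerivAt (fun u => (q u).Mβ) _ t :=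
    ((((hw 0).const_mul 2).mul hb0).add (((hw 1).const_mul 2).mul hb1)).add ((hw 2).mul hb2)
  have hM₁ : HasDerivAt (fun u => (q u).M₁) _ t := (hw 0).const_mul 2
  have hM₂ : HasDerivAt (fun u => (q u).M₂) _ t := (hw 1).const_mul 2
  refine ((hMα.mul hM₁).add (hMβ.mul hM₂)).congr_deriv ?_
  have hG1 := S_eq₁ hq
  have hG2 := S_eq₂ hq
  apply Complex.ofReal_injective
  have e0' : w 0 = ((q t).ω 1 * (q t).ω 2 + (q t).β 2) / 2 := by linarith
  have e1' : w 1 = (-((q t).ω 0 * (q t).ω 2) - (q t).α 2) / 2 := by linarith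
  rw [e0', e1', e2]
  trans Complex.I * (((q t).w₂ * (q t).w₃ + (q t).z₂) / 2 *
        ((q t).w₂ * (q t).x₁ + (q t).w₁ * (q t).y₂ + (q t).w₃ * (q t).z₁)
      + (q t).w₂ * ((q t).x₁ * (q t).z₂ - (q t).y₁ * (q t).z₁) / 2
      - ((q t).w₁ * (q t).w₃ + (q t).z₁) / 2 *
        ((q t).w₁ * (q t).x₂ + (q t).w₂ * (q t).y₁ + (q t).w₃ * (q t).z₂)
      - (q t).w₁ * ((q t).x₂ * (q t).z₁ - (q t).y₂ * (q t).z₂) / 2)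
  · apply Complex.ext <;>
      simp [Mα, Mβ, M₁, M₂, w₁, w₂, w₃, x₁, x₂, y₁, y₂, z₁, z₂] <;> ring
  · push_cast
    rw [ofReal_wSqRate, hG1, hG2]
    linear_combination (Complex.I / 2) * ((q t).z₂ * hG1 - (q t).z₁ * hG2)

theorem EulerPoissonAt.hasDerivAt_S {a b : ℝ} (h : EulerPoissonAt q t)
    (hq : q t ∈ setO a b) : HasDerivAt (fun u => (q u).S) 0 t := by
  have hL := h.hasDerivAt_momentum hq
  have hn := h.hasDerivAt_w_sq
  have hpos := sq_add_sq_pos hq.2.1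
  have hM : ∀ u, (q u).M₁ ^ 2 + (q u).M₂ ^ 2 = 4 * ((q u).ω 0 ^ 2 + (q u).ω 1 ^ 2) := by
    intro u; rw [M₁, M₂]; ring
  have hne : 4 * ((q t).ω 0 ^ 2 + (q t).ω 1 ^ 2) ≠ 0 := by positivity
  have := (hL.div (hn.const_mul 4) hne).neg
  simp only [S, hM]
  refine this.congr_deriv ?_
  rw [neg_eq_zero, div_eq_zero_iff]
  left
  have hS : (q t).S * (4 * ((q t).ω 0 ^ 2 + (q t).ω 1 ^ 2))
      = -((q t).Mα * (q t).M₁ + (q t).Mβ * (q t).M₂) := by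
    rw [S, hM, neg_mul, div_mul_cancel₀ _ hne]
  linear_combination -4 * (q t).wSqRate * hS

theorem EulerPoissonAt.hasDerivAt_T {a b : ℝ} (h : EulerPoissonAt q t)
    (hq : q t ∈ setO a b) : HasDerivAt (fun u => (q u).T a b) 0 t := by
  have hL := h.hasDerivAt_momentum hq
  obtain ⟨-, ⟨ha0, ha1, -⟩, hb0, hb1, -⟩ := h
  refine ((((hL.const_mul (1 / 2)).sub
    (((ha0.mul hb1).sub (ha1.mul hb0)).const_mul 2)).add_const _).add_const _).congr_deriv ?_
  have hG1 := S_eq₁ hq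
  have hG2 := S_eq₂ hq
  apply Complex.ofReal_injective
  trans -2 * (q t).S * ((q t).wSqRate : ℂ) +
    Complex.I / 2 * ((q t).x₂ * (q t).z₁ * (q t).w₁ - (q t).x₁ * (q t).z₂ * (q t).w₂
      - (q t).y₂ * (q t).w₁ * (q t).z₂ + (q t).y₁ * (q t).w₂ * (q t).z₁)
  · apply Complex.ext <;>
      simp [wSqRate, w₁, w₂, x₁, x₂, y₁, y₂, z₁, z₂] <;> ring
  · rw [ofReal_wSqRate]
    push_cast
    linear_combination (Complex.I / 2) * ((q t).z₁ * hG2 - (q t).z₂ * hG1)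

end Rates

/-! ### Nonvanishing of `S` and the value of `xμ` -/

/-- On `𝔒` the integral `S` vanishes only if `σ` does; this holds at each single point. -/
theorem S_ne_zero {a b p r : ℝ} {q : TopState} (hab : b < a) (hb : 0 < b)
    (hp : p ^ 2 = a ^ 2 + b ^ 2) (hr : r ^ 2 = a ^ 2 - b ^ 2) (hq : q ∈ setO a b)
    (hσ : sigma p r (q.T a b) ≠ 0) : q.S ≠ 0 := by
  intro hS
  have hG1 := S_eq₁ hq
  have hG2 := S_eq₂ hq
  have hT := T_eq hq
  have hW := R₂_eq hq
  have h1 := hq.2.1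
  have h2 := w₂_ne_zero h1
  have e1 := z₁_sq_add hr hq.1
  have e2 := z₂_sq_add hr hq.1
  have e3 := sum_sq hp hq.1
  rw [hS] at hG1 hG2 hT
  simp only [Complex.ofReal_zero, mul_zero, zero_mul] at hG1 hG2 hT
  have hr0 : 0 < r ^ 2 := by rw [hr]; nlinarith
  have f1 : q.x₂ * q.z₁ = q.y₂ * q.z₂ := by
    apply mul_left_cancel₀ h1
    linear_combination hW - q.z₂ * hG1 - q.w₃ * hT
  have f2 : q.x₁ * q.z₂ = q.y₁ * q.z₁ := by
    apply mul_left_cancel₀ h2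
    linear_combination hW - q.z₁ * hG2 - q.w₃ * hT
  have g1 : q.z₁ * (q.z₁ * q.z₂ + q.y₁ * q.y₂) = (r : ℂ) ^ 2 * q.z₂ := by
    linear_combination q.z₂ * e1 - q.y₂ * f2
  have g2 : q.z₂ * (q.z₁ * q.z₂ + q.y₁ * q.y₂) = (r : ℂ) ^ 2 * q.z₁ := by
    linear_combination q.z₁ * e2 - q.y₁ * f1
  have e4 : (q.x₁ * q.x₂) * (q.y₁ * q.y₂) =
      ((r : ℂ) ^ 2 - q.z₁ ^ 2) * ((r : ℂ) ^ 2 - q.z₂ ^ 2) := by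
    linear_combination (q.x₂ * q.y₁) * e1 + ((r : ℂ) ^ 2 - q.z₁ ^ 2) * e2
  -- `z₁ = 0` makes `τ = x²` a root of `σ`; otherwise `z₁` is real and `|x₁| = |y₁|` or `y₁ = 0`
  by_cases hz : q.z₁ = 0
  · have hz2 : q.z₂ = 0 := by
      simp only [z₁, z₂, Complex.ext_iff, Complex.zero_re, Complex.zero_im, neg_eq_zero] at hz ⊢
      exact hz
    apply hσ
    apply Complex.ofReal_injective
    rw [sigma]
    push_cast
    simp only [hz, hz2] at e3 e4 hT
    have hτ : (q.T a b : ℂ) = q.x₁ * q.x₂ := by linear_combination hT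
    rw [hτ]
    linear_combination (q.x₁ * q.x₂) * e3 - e4
  · have hzn : 0 < ‖q.z₁‖ ^ 2 := by positivity
    have hz2 : q.z₁ * q.z₂ ≠ 0 := by
      rw [z₁_mul_z₂]; exact_mod_cast hzn.ne'
    have h3 : (‖q.z₁‖ ^ 2 + ‖q.y₁‖ ^ 2) ^ 2 = (r ^ 2) ^ 2 := by
      apply Complex.ofReal_injective
      apply mul_left_cancel₀ hz2
      rw [Complex.ofReal_pow, Complex.ofReal_add, ← z₁_mul_z₂, ← y₁_mul_y₂]
      push_cast
      linear_combination (q.z₂ * (q.z₁ * q.z₂ + q.y₁ * q.y₂)) * g1 + (r : ℂ) ^ 2 * q.z₂ * g2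
    have h4 : ‖q.z₁‖ ^ 2 + ‖q.y₁‖ ^ 2 = r ^ 2 := by
      rwa [sq_eq_sq₀ (by positivity) hr0.le] at h3
    have h5 : q.z₁ * q.z₂ + q.y₁ * q.y₂ = (r : ℂ) ^ 2 := by
      rw [z₁_mul_z₂, y₁_mul_y₂, ← Complex.ofReal_add, h4]; push_cast; rfl
    have hr0' : (r : ℂ) ^ 2 ≠ 0 := by exact_mod_cast hr0.ne'
    have h6 : q.z₁ = q.z₂ := by
      apply mul_left_cancel₀ hr0'
      rw [h5] at g1
      linear_combination g1
    have h7 : q.x ^ 2 * ‖q.y₁‖ ^ 2 = ‖q.y₁‖ ^ 2 * ‖q.y₁‖ ^ 2 := by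
      apply Complex.ofReal_injective
      rw [Complex.ofReal_mul, Complex.ofReal_mul, ← x₁_mul_x₂, ← y₁_mul_y₂, e4, ← h6]
      rw [← h6] at h5
      rw [← h5]
      ring
    have h8 : q.x ^ 2 + ‖q.y₁‖ ^ 2 + 2 * ‖q.z₁‖ ^ 2 = 2 * p ^ 2 := by
      apply Complex.ofReal_injective
      have := e3
      rw [x₁_mul_x₂, y₁_mul_y₂, z₁_mul_z₂] at this
      exact_mod_cast this
    rcases eq_or_ne (‖q.y₁‖ ^ 2) 0 with h0 | h0
    · have hy : q.y₁ = 0 := by simpa using h0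
      have hx : q.x₁ = 0 := by
        rw [hy, zero_mul] at f2
        refine (mul_eq_zero.1 f2).resolve_right ?_
        rw [← h6]; exact hz
      have : q.x = 0 := by rw [x, hx, norm_zero]
      rw [this] at h8
      nlinarith
    · have := mul_right_cancel₀ h0 h7
      nlinarith

theorem x_mul_μ_sq {a b p r τ : ℝ} {q : TopState} (hp : p ^ 2 = a ^ 2 + b ^ 2)
    (hr : r ^ 2 = a ^ 2 - b ^ 2) (hq : q ∈ setO a b) (hτ : q.T a b = τ) :
    (q.x * q.μ r τ) ^ 2 =
      q.x ^ 2 * (sigma p r τ * (q.x ^ 2 - τ) + τ * q.ξ q.S ^ 2) := by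
  have h := mu_sq_identity (z₁_sq_add hr hq.1) (z₂_sq_add hr hq.1) (sum_sq hp hq.1)
    (ξ := 2 * q.S * (q.w₁ * q.w₂)) (τ := τ) (by rw [T_eq hq, hτ])
  rw [← μ_sq, x₁_mul_x₂, w₁_mul_w₂] at h
  rw [mul_pow]
  congr 1
  apply Complex.ofReal_injective
  rw [h, sigma, ξ]
  push_cast
  ring

/-! ### The branches of the square roots -/

/-- The numerator of `(U - V) dU/dt` over the denominator `σ(τ - X)³`, where `P = dX/dt`,
`N = dξ/dt` and `m = xμ`. The sign change `m ↦ -m` gives the one of `(V - U) dV/dt`. -/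
noncomputable def branchNumerator (τ σ X ξ P N m : ℝ) : ℝ :=
  τ * (P * ((τ + X) * ξ ^ 2 + 2 * ξ * m - σ * (τ - X)) + 2 * (τ - X) * N * (X * ξ + m))

open Topology in
/-- Whenever `U` and `V` are differentiable, `(U - V) dU/dt` is determined by the derivatives of
`U + V` and `(U - V)²`, which do not involve the possibly non-smooth function `m`. -/
theorem sub_mul_deriv_eq_branchNumerator {X ξ m : ℝ → ℝ} {P N τ σ t : ℝ} {c : ℂ} (hc0 : c ≠ 0)
    (hX : HasDerivAt X P t) (hξ : HasDerivAt ξ N t)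
    (hm : ∀ᶠ u in 𝓝 t, m u ^ 2 = X u * (σ * (X u - τ) + τ * ξ u ^ 2))
    (hT : τ - X t ≠ 0) {U V : ℝ → ℂ} {U' V' : ℂ}
    (hUd : ∀ u, U u = ((τ * ξ u + m u : ℝ) : ℂ) / (c * ((τ - X u : ℝ) : ℂ)))
    (hVd : ∀ u, V u = ((τ * ξ u - m u : ℝ) : ℂ) / (c * ((τ - X u : ℝ) : ℂ)))
    (hU : HasDerivAt U U' t) (hV : HasDerivAt V V' t) :
    (U t - V t) * U' =
      (branchNumerator τ σ (X t) (ξ t) P N (m t) : ℂ) / (c ^ 2 * ((τ - X t : ℝ) : ℂ) ^ 3) := by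
  have hT' : ((τ - X t : ℝ) : ℂ) ≠ 0 := by exact_mod_cast hT
  have hden : HasDerivAt (fun u => c * ((τ - X u : ℝ) : ℂ)) (c * ((-P : ℝ) : ℂ)) t :=
    ((hX.const_sub τ).ofReal_comp).const_mul c
  have hsum := ((hξ.const_mul (2 * τ)).ofReal_comp).div hden (mul_ne_zero hc0 hT')
  have hsum' : U' + V' = _ := (hU.add hV).unique (hsum.congr_of_eventuallyEq
    (Filter.Eventually.of_forall fun u => by
      simp only [Pi.add_apply, Pi.div_apply, hUd, hVd]
      rw [← add_div]; congr 1; push_cast; ring))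
  have hM := (hX.mul (((hX.sub_const τ).const_mul σ).add ((hξ.pow 2).const_mul τ))).const_mul 4
  have hdiff := (hM.ofReal_comp).div (hden.pow 2) (pow_ne_zero 2 (mul_ne_zero hc0 hT'))
  have hdiff' := ((hU.sub hV).pow 2).unique (hdiff.congr_of_eventuallyEq (by
      filter_upwards [hm] with u hu
      simp only [Pi.sub_apply, Pi.div_apply, Pi.pow_apply, Pi.mul_apply, Pi.add_apply, hUd, hVd,
        ← hu]
      rw [← sub_div, div_pow]; congr 1; push_cast; ring))
  have hUV : U t - V t = 2 * m t / (c * ((τ - X t : ℝ) : ℂ)) := by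
    rw [hUd, hVd, ← sub_div]; congr 1; push_cast; ring
  have key : (U t - V t) * U' = (1 / 4) * (2 * (U t - V t) * (U' - V'))
      + (1 / 2) * (U t - V t) * (U' + V') := by ring
  simp only [Nat.reduceSub, pow_one, Pi.sub_apply, Nat.cast_ofNat, Pi.pow_apply, Pi.mul_apply,
    Pi.add_apply] at hdiff'
  rw [key, hdiff', hsum', hUV, branchNumerator]
  push_cast at hT' ⊢
  field_simp
  ring

/-- The square of the branch is `Q(U)`, given the relations of `separation_identity`. -/
theorem sq_branch_eq_eval {p r s τ k : ℝ} {c d : ℂ} {X ξ P N m : ℝ}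
    (hk0 : 0 ≤ k) (hσ0 : sigma p r τ ≠ 0)
    (hc : c ^ 2 = (sigma p r τ : ℂ))
    (hd : d ^ 2 = ((2 * s * τ * sigma p r τ : ℝ) : ℂ))
    (hT : τ - X ≠ 0)
    (hk : 4 * s ^ 2 * k = 4 * s ^ 2 * τ + sigma p r τ)
    (hm : m ^ 2 = X * (sigma p r τ * (X - τ) + τ * ξ ^ 2))
    (h : 2 * s * (P ^ 2 * ((τ + X) * ξ ^ 2 + 2 * ξ * m - sigma p r τ * (τ - X))
        + 4 * (τ - X) * (P * N) * (X * ξ + m) + 4 * (τ - X) ^ 2 * (X * N ^ 2)) =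
      ((τ + X) * ξ ^ 2 + 2 * ξ * m - sigma p r τ * (τ - X) - 4 * s ^ 2 * (τ - X) ^ 2) *
      ((τ + X) * ξ ^ 2 + 2 * ξ * m - sigma p r τ * (τ - X)
        + 2 * (τ * ξ + m) * (τ - X) + 2 * (τ - p ^ 2) * (τ - X) ^ 2)) :
    (d * ((branchNumerator τ (sigma p r τ) X ξ P N m : ℂ)
        / (c ^ 2 * ((τ - X : ℝ) : ℂ) ^ 3))) ^ 2 =
      (sexticQ p r s τ (Real.sqrt k) c).eval
        (((τ * ξ + m : ℝ) : ℂ) / (c * ((τ - X : ℝ) : ℂ))) := by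
  have hc0 : c ≠ 0 := by
    rintro rfl
    apply hσ0
    have : (sigma p r τ : ℂ) = 0 := by rw [← hc]; simp
    exact_mod_cast this
  have hσd : sigma p r τ = τ ^ 2 - 2 * p ^ 2 * τ + r ^ 4 := rfl
  rw [sexticQ]
  generalize sigma p r τ = σ at *
  have hT' : (τ : ℂ) - X ≠ 0 := by exact_mod_cast hT
  have hσ' : (σ : ℂ) ≠ 0 := by exact_mod_cast hσ0
  have hmC : (m : ℂ) ^ 2 = X * (σ * (X - τ) + τ * ξ ^ 2) := by exact_mod_cast hm
  have hkC : 4 * (s : ℂ) ^ 2 * k = 4 * s ^ 2 * τ + σ := by exact_mod_cast hk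
  have hσC : (σ : ℂ) = τ ^ 2 - 2 * p ^ 2 * τ + r ^ 4 := by exact_mod_cast hσd
  have hC := congrArg ((↑) : ℝ → ℂ) h
  simp only [Polynomial.eval_mul, Polynomial.eval_sub, Polynomial.eval_pow, Polynomial.eval_X,
    Polynomial.eval_one, Polynomial.eval_C, Polynomial.eval_add, Real.sq_sqrt hk0,
    branchNumerator]
  push_cast at hd hC ⊢
  have hcu : c * ((τ * ξ + m) / (c * (τ - X))) = (τ * ξ + m) / ((τ : ℂ) - X) := by
    field_simp
  have hu2 : ((τ * ξ + m) / (c * (τ - X))) ^ 2 = ((τ * ξ + m : ℂ)) ^ 2 / (σ * (τ - X) ^ 2) := by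
    rw [div_pow, mul_pow, hc]
  set φ : ℂ := (τ + X) * ξ ^ 2 + 2 * ξ * m - σ * (τ - X) with hφ
  have h1 : ((τ * ξ + m : ℂ)) ^ 2 / (σ * (τ - X) ^ 2) - 1 = τ * φ / (σ * (τ - X) ^ 2) := by
    rw [hφ]; field_simp; linear_combination hmC
  have h2 : σ * (((τ * ξ + m : ℂ)) ^ 2 / (σ * (τ - X) ^ 2)) - 4 * s ^ 2 * k
      = τ * (φ - 4 * s ^ 2 * (τ - X) ^ 2) / (τ - X) ^ 2 := by
    rw [hkC, hφ]; field_simp; linear_combination hmC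
  have h3 : ((τ * ξ + m) / ((τ : ℂ) - X) + τ) ^ 2 - r ^ 4
      = τ * (φ + 2 * (τ * ξ + m) * (τ - X) + 2 * (τ - p ^ 2) * (τ - X) ^ 2) / (τ - X) ^ 2 := by
    rw [hφ]; field_simp; linear_combination hmC + (τ - X : ℂ) ^ 2 * hσC
  -- Since `(Xξ + m)² = Xφ` is a multiple of `φ`, so is the whole square.
  have h4 : (P * φ + 2 * (τ - X) * N * (X * ξ + m)) ^ 2 =
      φ * (P ^ 2 * φ + 4 * (τ - X) * (P * N) * (X * ξ + m) + 4 * (τ - X) ^ 2 * (X * N ^ 2)) := by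
    rw [hφ]; linear_combination (4 * (τ - X : ℂ) ^ 2 * N ^ 2) * hmC
  rw [hcu, hu2, h1, h2, h3, mul_pow, div_pow, mul_pow, mul_pow, h4, hd, hc]
  clear_value φ
  generalize φ + 2 * (τ * ξ + m) * (τ - X) + 2 * (τ - p ^ 2) * (τ - X : ℂ) ^ 2 = F₂ at hC ⊢
  generalize φ - 4 * s ^ 2 * (τ - X : ℂ) ^ 2 = F₁ at hC ⊢
  generalize P ^ 2 * φ + 4 * (τ - X) * (P * N) * (X * ξ + m) + 4 * (τ - X : ℂ) ^ 2 * (X * N ^ 2)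
    = E at hC ⊢
  trans τ ^ 3 * φ * (2 * s * E) / (σ * ((τ : ℂ) - X) ^ 6)
  · field_simp
  · rw [hC]; field_simp

theorem natDegree_sexticQ {p r s τ χ : ℝ} {c : ℂ} (hσ0 : sigma p r τ ≠ 0)
    (hc0 : c ≠ 0) : (sexticQ p r s τ χ c).natDegree = 6 := by
  have : (sigma p r τ : ℂ) ≠ 0 := by exact_mod_cast hσ0
  rw [sexticQ]
  compute_degree!

theorem EulerPoissonAt.continuousAt {q : ℝ → TopState} {t : ℝ} (h : EulerPoissonAt q t) :
    (∀ j, ContinuousAt (fun u => (q u).ω j) t) ∧ (∀ j, ContinuousAt (fun u => (q u).α j) t) ∧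
      ∀ j, ContinuousAt (fun u => (q u).β j) t := by
  obtain ⟨⟨w, hw, -⟩, ⟨ha0, ha1, ha2⟩, hb0, hb1, hb2⟩ := h
  refine ⟨fun j => (hw j).continuousAt, fun j => ?_, fun j => ?_⟩
  · fin_cases j
    exacts [ha0.continuousAt, ha1.continuousAt, ha2.continuousAt]
  · fin_cases j
    exacts [hb0.continuousAt, hb1.continuousAt, hb2.continuousAt]

/-- The sign `ε = ±1` distinguishes the branches belonging to `U` and to `V`. -/
theorem EulerPoissonAt.continuousAt_branchNumerator {q : ℝ → TopState} {t : ℝ}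
    (h : EulerPoissonAt q t) (r s τ σ ε : ℝ) :
    ContinuousAt (fun u => branchNumerator τ σ ((q u).x ^ 2) ((q u).ξ s) (q u).xSqRate
      (2 * s * (q u).wSqRate) (ε * ((q u).x * (q u).μ r τ))) t := by
  obtain ⟨hω, hα, hβ⟩ := h.continuousAt
  have hx : ∀ v : TopState, v.x = Real.sqrt ((v.α 0 - v.β 1) ^ 2 + (v.α 1 + v.β 0) ^ 2) :=
    fun v => by rw [← x_sq, Real.sqrt_sq (show 0 ≤ v.x from norm_nonneg _)]
  have hμ : ∀ v : TopState, v.μ r τ = Real.sqrt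
      ((r ^ 2 * (v.α 0 - v.β 1) - τ * (v.α 0 + v.β 1)) ^ 2
      + (r ^ 2 * (v.α 1 + v.β 0) - τ * (v.α 1 - v.β 0)) ^ 2) :=
    fun v => by rw [← μ_sq_eq, Real.sqrt_sq (show 0 ≤ v.μ r τ from norm_nonneg _)]
  simp only [branchNumerator, ξ, xSqRate, wSqRate, x₁, z₂, w₂, w₁, hx, hμ, Complex.mul_re,
    Complex.mul_im]
  fun_prop

theorem continuousOn_branch {q : ℝ → TopState} {I : Set ℝ} (r s τ σ ε : ℝ)
    (hmotion : ∀ t ∈ I, EulerPoissonAt q t) (e : ℂ) :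
    ContinuousOn (fun u => e * ((branchNumerator τ σ ((q u).x ^ 2) ((q u).ξ s) (q u).xSqRate
      (2 * s * (q u).wSqRate) (ε * ((q u).x * (q u).μ r τ)) : ℂ)
        / ((σ : ℂ) * ((τ - (q u).x ^ 2 : ℝ) : ℂ) ^ 3))) {t | t ∈ I ∧ τ - (q t).x ^ 2 ≠ 0} := by
  -- for `σ = 0` the quotient is `0` by convention
  by_cases hσ : σ = 0
  · simp [hσ, continuousOn_const]
  rintro t ⟨htI, hT⟩
  have h := hmotion t htI
  have h1 := h.continuousAt_branchNumerator r s τ σ ε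
  have h2 := h.hasDerivAt_x_sq.continuousAt
  have h3 : (σ : ℂ) * ((τ - (q t).x ^ 2 : ℝ) : ℂ) ^ 3 ≠ 0 := by
    refine mul_ne_zero (by exact_mod_cast hσ) (pow_ne_zero _ (by exact_mod_cast hT))
  refine ContinuousAt.continuousWithinAt (continuousAt_const.mul (ContinuousAt.div ?_ ?_ h3))
  · exact Complex.continuous_ofReal.continuousAt.comp h1
  · exact continuousAt_const.mul
      ((Complex.continuous_ofReal.continuousAt.comp (continuousAt_const.sub h2)).pow 3)

theorem constant_integrals {a b : ℝ} {q : ℝ → TopState} {I : Set ℝ} (hI : IsOpen I)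
    (hconn : IsPreconnected I) (hmotion : ∀ t ∈ I, EulerPoissonAt q t)
    (hO : ∀ t ∈ I, q t ∈ setO a b) {t t₀ : ℝ} (ht : t ∈ I) (ht₀ : t₀ ∈ I) :
    (q t).S = (q t₀).S ∧ (q t).T a b = (q t₀).T a b ∧ (q t).K = (q t₀).K := by
  have key : ∀ f : ℝ → ℝ, (∀ u ∈ I, HasDerivAt f 0 u) → f t = f t₀ := fun f hf =>
    hI.is_const_of_deriv_eq_zero hconn
      (fun u hu => (hf u hu).differentiableAt.differentiableWithinAt)
      (fun u hu => (hf u hu).deriv) ht ht₀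
  exact ⟨key _ fun u hu => (hmotion u hu).hasDerivAt_S (hO u hu),
    key _ fun u hu => (hmotion u hu).hasDerivAt_T (hO u hu),
    key _ fun u hu => (hmotion u hu).hasDerivAt_K⟩

/-- The branch belonging to either choice `m = ±xμ` squares to the value of `Q`, at each point
of `𝔒` with `x² ≠ τ`. -/
theorem separation_at {a b p r s τ k : ℝ} {q : TopState}
    (hp : p ^ 2 = a ^ 2 + b ^ 2) (hr : r ^ 2 = a ^ 2 - b ^ 2) (hq : q ∈ setO a b)
    (hs : q.S = s) (hτ : q.T a b = τ) (hk : q.K = k) (hT : τ - q.x ^ 2 ≠ 0)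
    {m : ℝ} (hm : m ^ 2 = (q.x * q.μ r τ) ^ 2) {c d : ℂ}
    (hσ0 : sigma p r τ ≠ 0)
    (hc : c ^ 2 = (sigma p r τ : ℂ))
    (hd : d ^ 2 = ((2 * s * τ * sigma p r τ : ℝ) : ℂ)) :
    (d * ((branchNumerator τ (sigma p r τ) (q.x ^ 2) (q.ξ s) q.xSqRate (2 * s * q.wSqRate) m : ℂ)
        / (c ^ 2 * ((τ - q.x ^ 2 : ℝ) : ℂ) ^ 3))) ^ 2 =
      (sexticQ p r s τ (Real.sqrt k) c).eval
        (((τ * q.ξ s + m : ℝ) : ℂ) / (c * ((τ - q.x ^ 2 : ℝ) : ℂ))) := by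
  have hk0 : 0 ≤ k := by rw [← hk, K]; positivity
  have hm' : m ^ 2 = q.x ^ 2 * (sigma p r τ * (q.x ^ 2 - τ) + τ * q.ξ s ^ 2) := by
    rw [hm, x_mul_μ_sq hp hr hq hτ, hs]
  subst hs hτ hk
  obtain ⟨h1, h2⟩ := separation_identity hq.2.1 (w₂_ne_zero hq.2.1)
    (by rw [x₁_mul_x₂]; exact_mod_cast hT)
    (z₁_sq_add hr hq.1) (z₂_sq_add hr hq.1) (sum_sq hp hq.1) (S_eq₁ hq) (S_eq₂ hq) (R₂_eq hq)
    (T_eq hq) (K_eq q) (X := ((q.x ^ 2 : ℝ) : ℂ)) (ξ := (q.ξ q.S : ℂ)) (P := (q.xSqRate : ℂ))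
    (N := ((2 * q.S * q.wSqRate : ℝ) : ℂ)) (m := (m : ℂ)) (σ := (sigma p r (q.T a b) : ℂ))
    (x₁_mul_x₂ q).symm (by rw [w₁_mul_w₂, ξ]; push_cast; ring) (by rw [sigma]; push_cast; ring)
    (ofReal_xSqRate q) (by push_cast; rw [ofReal_wSqRate]; ring)
    (by exact_mod_cast hm')
  exact sq_branch_eq_eval hk0 hσ0 hc hd hT (by exact_mod_cast h1) hm' (by exact_mod_cast h2)

end TopState

theorem theorem5
    (a b p r : ℝ) (hab : b < a) (hb : 0 < b)
    (hp : p ^ 2 = a ^ 2 + b ^ 2) (hr : r ^ 2 = a ^ 2 - b ^ 2)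
    -- a motion on `𝔒`, given on an open time interval `I`
    (q : ℝ → TopState) (I : Set ℝ) (hI : IsOpen I) (hconn : IsPreconnected I)
    (hmotion : ∀ t ∈ I, TopState.EulerPoissonAt q t)
    (hO : ∀ t ∈ I, q t ∈ TopState.setO a b)
    -- the constants of its integrals `S`, `Τ`, `K`
    (s τ k : ℝ) (t₀ : ℝ) (ht₀ : t₀ ∈ I)
    (hs : (q t₀).S = s) (hτ : (q t₀).T a b = τ) (hk : (q t₀).K = k)
    (hτσ : τ * TopState.sigma p r τ ≠ 0)
    -- `c = √σ` and `d = √(2sτσ)`, with any choice of the roots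
    (c d : ℂ) (hc : c ^ 2 = (TopState.sigma p r τ : ℂ))
    (hd : d ^ 2 = ((2 * s * τ * TopState.sigma p r τ : ℝ) : ℂ)) :
    let Q : Polynomial ℂ := TopState.sexticQ p r s τ (Real.sqrt k) c
    let U : ℝ → ℂ := fun t => (q t).U r s τ c
    let V : ℝ → ℂ := fun t => (q t).V r s τ c
    -- the times at which `U` and `V` are defined
    let J : Set ℝ := {t | t ∈ I ∧ τ - (q t).x ^ 2 ≠ 0}
    s ≠ 0 ∧ d ≠ 0 ∧ Q.natDegree = 6 ∧
    (∀ t ∈ J, (q t).x ≠ 0 → (q t).μ r τ ≠ 0 →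
      DifferentiableAt ℝ U t ∧ DifferentiableAt ℝ V t) ∧
    -- continuous branches of `√Q(U)` and `√Q(V)` along the motion
    ∃ A B : ℝ → ℂ, ContinuousOn A J ∧ ContinuousOn B J ∧
      ∀ t ∈ J, A t ^ 2 = Q.eval (U t) ∧ B t ^ 2 = Q.eval (V t) ∧
        ∀ U' V' : ℂ, HasDerivAt U U' t → HasDerivAt V V' t →
          (U t - V t) * U' = A t / d ∧ (U t - V t) * V' = B t / d ∧
          (Q.eval (U t) ≠ 0 → Q.eval (V t) ≠ 0 →
            U' / A t - V' / B t = 0 ∧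
            U t * U' / A t - V t * V' / B t = 1 / d) := by
  intro Q U V J
  obtain ⟨hτ0, hσ0⟩ := mul_ne_zero_iff.1 hτσ
  have hs0 : s ≠ 0 := by
    rw [← hs]
    exact TopState.S_ne_zero hab hb hp hr (hO t₀ ht₀) (by rwa [hτ])
  have hd0 : d ≠ 0 := by
    rintro rfl
    have h0 : 2 * s * τ * TopState.sigma p r τ = 0 := by
      apply Complex.ofReal_injective; rw [← hd]; simp
    simp [hs0, hτ0, hσ0] at h0
  have hc0 : c ≠ 0 := by
    rintro rfl
    apply hσ0
    apply Complex.ofReal_injective; rw [← hc]; simp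
  set σ := TopState.sigma p r τ with hσ
  have hconst : ∀ t ∈ I, (q t).S = s ∧ (q t).T a b = τ ∧ (q t).K = k := fun t ht => by
    have := TopState.constant_integrals hI hconn hmotion hO ht ht₀
    rwa [hs, hτ, hk] at this
  refine ⟨hs0, hd0, TopState.natDegree_sexticQ hσ0 hc0, ?_, ?_⟩
  · rintro t ⟨htI, hT⟩ hx hμ
    have hX := (hmotion t htI).hasDerivAt_x_sq.differentiableAt
    have hξ : DifferentiableAt ℝ (fun u => (q u).ξ s) t :=
      (hmotion t htI).hasDerivAt_w_sq.differentiableAt.const_mul _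
    have hxd : DifferentiableAt ℝ (fun u => (q u).x * (q u).μ r τ) t := by
      obtain ⟨-, ⟨ha0, ha1, -⟩, hb0, hb1, -⟩ := hmotion t htI
      have hx2 : DifferentiableAt ℝ (fun u => (q u).x) t := by
        have := hX.sqrt (pow_ne_zero 2 hx)
        simpa [TopState.x] using this
      have hμ1 : DifferentiableAt ℝ (fun u => (q u).μ r τ ^ 2) t := by
        have a0 := ha0.differentiableAt
        have a1 := ha1.differentiableAt
        have b0 := hb0.differentiableAt
        have b1 := hb1.differentiableAt
        simp only [TopState.μ_sq_eq]
        fun_prop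
      have hμ2 : DifferentiableAt ℝ (fun u => (q u).μ r τ) t := by
        have := hμ1.sqrt (pow_ne_zero 2 hμ)
        simpa [TopState.μ] using this
      exact hx2.mul hμ2
    have hofReal : ∀ f : ℝ → ℝ, DifferentiableAt ℝ f t →
        DifferentiableAt ℝ (fun u => (f u : ℂ)) t :=
      fun f hf => hf.hasDerivAt.ofReal_comp.differentiableAt
    have hden : DifferentiableAt ℝ (fun u => c * ((τ - (q u).x ^ 2 : ℝ) : ℂ)) t :=
      (hofReal _ (hX.const_sub τ)).const_mul c
    have hne : c * ((τ - (q t).x ^ 2 : ℝ) : ℂ) ≠ 0 := mul_ne_zero hc0 (by exact_mod_cast hT)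
    exact ⟨(hofReal _ ((hξ.const_mul τ).add hxd)).div hden hne,
      (hofReal _ ((hξ.const_mul τ).sub hxd)).div hden hne⟩
  · refine ⟨_, _, TopState.continuousOn_branch r s τ σ 1 hmotion d,
      TopState.continuousOn_branch r s τ σ (-1) hmotion (-d), ?_⟩
    rintro t ⟨htI, hT⟩
    obtain ⟨hst, hτt, hkt⟩ := hconst t htI
    set m := (q t).x * (q t).μ r τ with hm
    have hA := TopState.separation_at hp hr (hO t htI) hst hτt hkt hT (m := 1 * m)
      (by ring) hσ0 hc hd
    have hB := TopState.separation_at hp hr (hO t htI) hst hτt hkt hT (m := -1 * m)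
      (by ring) hσ0 hc hd
    have hUt : U t = ((τ * (q t).ξ s + 1 * m : ℝ) : ℂ) / (c * ((τ - (q t).x ^ 2 : ℝ) : ℂ)) := by
      rw [one_mul]; rfl
    have hVt : V t = ((τ * (q t).ξ s + -1 * m : ℝ) : ℂ) / (c * ((τ - (q t).x ^ 2 : ℝ) : ℂ)) := by
      rw [neg_one_mul, ← sub_eq_add_neg]; rfl
    rw [← hUt, hc] at hA
    rw [← hVt, hc, ← neg_sq, ← neg_mul] at hB
    refine ⟨hA, hB, fun U' V' hU hV => ?_⟩
    have hX := (hmotion t htI).hasDerivAt_x_sq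
    have hξ : HasDerivAt (fun u => (q u).ξ s) (2 * s * (q t).wSqRate) t :=
      (hmotion t htI).hasDerivAt_w_sq.const_mul _
    have hmu : ∀ ε : ℝ, ε ^ 2 = 1 → ∀ᶠ u in nhds t, (ε * ((q u).x * (q u).μ r τ)) ^ 2 =
        (q u).x ^ 2 * (σ * ((q u).x ^ 2 - τ) + τ * (q u).ξ s ^ 2) := fun ε hε => by
      filter_upwards [hI.mem_nhds htI] with u hu
      obtain ⟨h1, h2, -⟩ := hconst u hu
      rw [mul_pow, hε, one_mul, TopState.x_mul_μ_sq hp hr (hO u hu) h2, h1]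
    have hU1 := TopState.sub_mul_deriv_eq_branchNumerator hc0 hX hξ (hmu 1 (by norm_num)) hT
      (U := U) (V := V) (fun u => by rw [one_mul]; rfl) (fun u => by rw [one_mul]; rfl) hU hV
    have hV1 := TopState.sub_mul_deriv_eq_branchNumerator hc0 hX hξ (hmu (-1) (by norm_num)) hT
      (U := V) (V := U) (fun u => by rw [neg_one_mul, ← sub_eq_add_neg]; rfl)
      (fun u => by rw [neg_one_mul, sub_neg_eq_add]; rfl) hV hU
    rw [hc] at hU1 hV1
    have hV2 : (U t - V t) * V' = -((V t - U t) * V') := by ring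
    rw [hV1] at hV2
    simp only [← hm] at hU1 hV2 ⊢
    generalize hα : (TopState.branchNumerator τ σ _ _ _ _ (1 * m) : ℂ) / _ = α at hA hU1 ⊢
    generalize hβ : (TopState.branchNumerator τ σ _ _ _ _ (-1 * m) : ℂ) / _ = β at hB hV2 ⊢
    refine ⟨by rw [hU1, mul_div_cancel_left₀ _ hd0], by rw [hV2]; field_simp, fun hQU hQV => ?_⟩
    rw [← hA] at hQU
    rw [← hB] at hQV
    have hα0 : α ≠ 0 := by rintro rfl; simp at hQU
    have hβ0 : β ≠ 0 := by rintro rfl; simp at hQV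
    -- `U = V` would make the branch vanish, against `Q(U) ≠ 0`
    have hUV : U t - V t ≠ 0 := by
      intro h; rw [h, zero_mul] at hU1; exact hα0 hU1.symm
    have e1 : U' = α / (U t - V t) := by rw [← hU1]; field_simp
    have e2 : V' = -β / (U t - V t) := by rw [← hV2]; field_simp
    rw [e1, e2]
    constructor
    · field_simp; ring
    · field_simp
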